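/- Let $\mathbf H$ be the skew field of real quaternions and let $n\ge 1$. For $M=(m_{kl})\in \mathrm M(n,\mathbf H)$ and $1\le i\le n$, the $i$-th row determinant of $M$ is $$\mathrm{rdet}_i\,M=\sum_{\sigma\in S_n}(-1)^{n-r}\,\bigl(m_{i\,i_{k_1}}m_{i_{k_1}i_{k_1+1}}\cdots m_{i_{k_1+l_1}\,i}\bigr)\cdots\bigl(m_{i_{k_r}i_{k_r+1}}\cdots m_{i_{k_r+l_r}i_{k_r}}\bigr),$$ where $\sigma=(i\,i_{k_1}\ldots i_{k_1+l_1})(i_{k_2}\ldots i_{k_2+l_2})\cdots(i_{k_r}\ldots i_{k_r+l_r})$ is the decomposition of $\sigma$ into $r$ disjoint cycles (fixed points included), written so that $i$ opens the first cycle, every other cycle is opened by its least element, and $i_{k_2}<i_{k_3}<\cdots<i_{k_r}$. A cycle $(a_1a_2\ldots a_s)$ sends $a_1\mapsto a_2\mapsto\cdots\mapsto a_s\mapsto a_1$. For a Hermitian matrix $M$ all row determinants $\mathrm{rdet}_i\,M$ are equal and real; their common value is denoted $\det M$. For $A\in \mathrm M(n,\mathbf H)$ let $A^*$ be the conjugate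 transpose of $A$ and let $\mathrm{ddet}\,A=\det(A^*A)$ be its double determinant. Denote by $M_{i.}(b)$ the matrix obtained from $M$ by replacing its $i$-th row with the row $b$. **Theorem.** Let $A\in \mathrm M(n,\mathbf H)$, let $y=(y_1,\ldots,y_n)\in\mathbf H^{1\times n}$, and suppose that $\mathrm{ddet}\,A\ne 0$. Then the left system of linear equations $x\cdot A=y$ has exactly one solution $x=(x_1,\ldots,x_n)\in\mathbf H^{1\times n}$, and it is given by $$x_i=\frac{\mathrm{rdet}_i\bigl((AA^*)_{i.}(z)\bigr)}{\mathrm{ddet}\,A}\qquad(i=1,\ldots,n),\qquad\text{where } z=yA^*.$$ -/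

import Mathlib

open scoped Quaternion Matrix

/-- The cycle of the permutation `σ` through `k`, written with `k` first:
`[k, σ k, σ (σ k), …]`, each element of the cycle once (`[k]` if `k` is a fixed point). -/
def cycleWord {n : ℕ} (σ : Equiv.Perm (Fin n)) (k : Fin n) : List (Fin n) :=
  List.iterate σ k (Finset.univ.filter fun m => σ.SameCycle k m).card

/-- The elements that open the cycles in the left-ordered cycle notation of `σ` used for the
`i`-th row determinant: first `i`, then, for the cycles that do not contain `i`,
their least elements, in increasing order. -/
def cycleHeads {n : ℕ} (σ : Equiv.Perm (Fin n)) (i : Fin n) : List (Fin n) :=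
  i :: (List.finRange n).filter fun m => ¬ σ.SameCycle i m ∧ ∀ j, σ.SameCycle m j → m ≤ j

/-- The left-ordered cycle notation of `σ` used for the `i`-th row determinant,
with the parentheses erased; every index occurs in it exactly once. -/
def leftOrderedWord {n : ℕ} (σ : Equiv.Perm (Fin n)) (i : Fin n) : List (Fin n) :=
  (cycleHeads σ i).flatMap (cycleWord σ)

/-- The `i`-th row determinant of a square matrix over a (noncommutative) ring: the alternating
sum over all permutations `σ` of the products of the entries `A k (σ k)`, multiplied from left to
right in the order in which `k` runs through the left-ordered cycle notation of `σ`
that starts with `i`. -/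
def rdet {n : ℕ} {R : Type*} [Ring R] (i : Fin n) (A : Matrix (Fin n) (Fin n) R) : R :=
  ∑ σ : Equiv.Perm (Fin n),
    Equiv.Perm.sign σ • ((leftOrderedWord σ i).map fun k => A k (σ k)).prod

/-- The double determinant of a quaternionic matrix: the determinant of the Hermitian matrix
`Aᴴ * A`. The determinant of a Hermitian matrix is the common value of its row determinants,
and is read off here at the first row. -/
noncomputable def ddet {n : ℕ} [NeZero n] (A : Matrix (Fin n) (Fin n) ℍ[ℝ]) : ℍ[ℝ] :=
  rdet 0 (Aᴴ * A)

/-!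
Write `z = y ᵥ* Aᴴ` and `H = A * Aᴴ`. A solution of `x ᵥ* A = y` satisfies `x ᵥ* H = z`, so the
`i`-th row of the matrix in the numerator is the left combination `∑ k, x k • H k` of the rows
of `H`. Every product in the `i`-th row determinant begins with an entry of row `i`, so the row
determinant is left linear in that row. Cramer's rule, with `ddet A` as denominator, thus amounts
to three facts.

* All row determinants of a Hermitian matrix are equal and real (`rdet_eq_hermitianDet`). Reversing
  one cycle of a permutation keeps its sign and conjugates the product along this cycle, so in
  the sum over all permutations every cyclic product may be replaced by its real part
  (`rdet_eq_sum_re`), and real parts of cyclic products do not depend on where the cycle is opened.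
* The `i`-th row determinant of `H` vanishes when row `i` is replaced by row `k ≠ i`
  (`rdet_updateRow_eq_zero`). Multiplication by the transposition of `i` and `k` pairs the
  permutations with `i` and `k` on different cycles with those having them on one cycle. It changes
  the sign, and the product along the joined cycle is the product of the two separate ones
  (`cycleProd_mul_swap`). After averaging over the orientation of the cycle of `k`, the terms
  cancel.
* `A * Aᴴ` and `Aᴴ * A` have the same determinant (`hermitianDet_mul_conjTranspose`). By the first
  two facts, multiplying by a matrix that differs from the identity in one row scales the
  determinant of `E * H * Eᴴ` by the norm of the diagonal entry (`hermitianDet_rowMatrix_mul_mul`).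
  So for dilations and transvections the congruences by `E` and by `Eᴴ` have the same factor, and
  Gaussian elimination extends this to all invertible matrices (`hasMultiplier_of_isUnit`).

Finally, Cramer's rule for `Aᴴ * A` shows that `x ᵥ* (Aᴴ * A) = 0` forces `x = 0` if
`ddet A ≠ 0`, so `A` is invertible (`isUnit_of_hermitianDet_ne_zero`).
-/

/-! ### Words of cycles -/

section Cycles

variable {n : ℕ}

/-- The number of elements of the cycle of `σ` through `k`. -/
def cycleSize (σ : Equiv.Perm (Fin n)) (k : Fin n) : ℕ :=
  (Finset.univ.filter fun m => σ.SameCycle k m).card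

theorem exists_iterate_eq {σ : Equiv.Perm (Fin n)} {k m : Fin n} (h : σ.SameCycle k m) :
    ∃ a, σ^[a] k = m := by
  obtain ⟨a, ha⟩ := h.exists_nat_pow_eq
  exact ⟨a, by rw [← ha, Equiv.Perm.iterate_eq_pow]⟩

theorem sameCycle_iterate (σ : Equiv.Perm (Fin n)) (k : Fin n) (a : ℕ) :
    σ.SameCycle k (σ^[a] k) :=
  ⟨a, by rw [zpow_natCast, Equiv.Perm.iterate_eq_pow]⟩

theorem cycleSize_eq_minimalPeriod (σ : Equiv.Perm (Fin n)) (k : Fin n) :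
    cycleSize σ k = Function.minimalPeriod σ k := by
  have hper : k ∈ Function.periodicPts σ :=
    ⟨orderOf σ, orderOf_pos σ, by
      rw [Function.IsPeriodicPt, Function.IsFixedPt, Equiv.Perm.iterate_eq_pow,
        pow_orderOf_eq_one, Equiv.Perm.one_apply]⟩
  have himg : (Finset.univ.filter fun m => σ.SameCycle k m) =
      (Finset.range (Function.minimalPeriod σ k)).image fun a => σ^[a] k := by
    ext m
    simp only [Finset.mem_filter, Finset.mem_univ, true_and, Finset.mem_image, Finset.mem_range]
    constructor
    · intro h
      obtain ⟨a, rfl⟩ := exists_iterate_eq h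
      exact ⟨a % Function.minimalPeriod σ k,
        Nat.mod_lt _ (Function.minimalPeriod_pos_of_mem_periodicPts hper),
        Function.iterate_mod_minimalPeriod_eq⟩
    · rintro ⟨a, -, rfl⟩
      exact sameCycle_iterate σ k a
  rw [cycleSize, himg, Finset.card_image_of_injOn, Finset.card_range]
  intro a ha b hb hab
  exact Function.iterate_injOn_Iio_minimalPeriod (by simpa using ha) (by simpa using hb) hab

theorem iterate_cycleSize (σ : Equiv.Perm (Fin n)) (k : Fin n) : σ^[cycleSize σ k] k = k := by
  rw [cycleSize_eq_minimalPeriod]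
  exact Function.iterate_minimalPeriod

theorem iterate_ne_of_lt_cycleSize {σ : Equiv.Perm (Fin n)} {k : Fin n} {a : ℕ} (ha : 0 < a)
    (h : a < cycleSize σ k) : σ^[a] k ≠ k := by
  rw [cycleSize_eq_minimalPeriod] at h
  exact fun hk => Function.not_isPeriodicPt_of_pos_of_lt_minimalPeriod ha.ne' h hk

theorem cycleSize_pos (σ : Equiv.Perm (Fin n)) (k : Fin n) : 0 < cycleSize σ k :=
  Finset.card_pos.2 ⟨k, by simp [Equiv.Perm.SameCycle.refl]⟩

theorem cycleWord_eq_iterate (σ : Equiv.Perm (Fin n)) (k : Fin n) :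
    cycleWord σ k = List.iterate σ k (cycleSize σ k) := rfl

theorem cycleWord_eq_cons (σ : Equiv.Perm (Fin n)) (k : Fin n) :
    cycleWord σ k = k :: (cycleWord σ k).tail := by
  rw [cycleWord_eq_iterate]
  obtain ⟨N, hN⟩ := Nat.exists_eq_succ_of_ne_zero (cycleSize_pos σ k).ne'
  rw [hN]; rfl

theorem notMem_tail_cycleWord (σ : Equiv.Perm (Fin n)) (k : Fin n) :
    k ∉ (cycleWord σ k).tail := by
  rw [cycleWord_eq_iterate]
  obtain ⟨N, hN⟩ := Nat.exists_eq_succ_of_ne_zero (cycleSize_pos σ k).ne'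
  rw [hN]
  simp only [List.iterate, List.tail_cons, List.mem_iterate]
  rintro ⟨a, ha, h⟩
  exact iterate_ne_of_lt_cycleSize (σ := σ) (k := k) (a := a + 1) (by omega) (by omega)
    (by rw [Function.iterate_succ_apply]; exact h.symm)

theorem sameCycle_of_mem_cycleWord {σ : Equiv.Perm (Fin n)} {k m : Fin n}
    (h : m ∈ cycleWord σ k) : σ.SameCycle k m := by
  rw [cycleWord_eq_iterate, List.mem_iterate] at h
  obtain ⟨a, -, rfl⟩ := h
  exact sameCycle_iterate σ k a

theorem iterate_congr_of_sameCycle {σ τ : Equiv.Perm (Fin n)} {k : Fin n}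
    (h : ∀ m, σ.SameCycle k m → τ m = σ m) (a : ℕ) : τ^[a] k = σ^[a] k := by
  induction a with
  | zero => rfl
  | succ a ih =>
    rw [Function.iterate_succ_apply', Function.iterate_succ_apply', ih,
      h _ (sameCycle_iterate σ k a)]

theorem sameCycle_congr {σ τ : Equiv.Perm (Fin n)} {k : Fin n}
    (h : ∀ m, σ.SameCycle k m → τ m = σ m) (m : Fin n) :
    τ.SameCycle k m ↔ σ.SameCycle k m := by
  constructor
  · intro hm
    obtain ⟨a, rfl⟩ := exists_iterate_eq hm
    rw [iterate_congr_of_sameCycle h]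
    exact sameCycle_iterate σ k a
  · intro hm
    obtain ⟨a, rfl⟩ := exists_iterate_eq hm
    rw [← iterate_congr_of_sameCycle h]
    exact sameCycle_iterate τ k a

theorem cycleSize_congr {σ τ : Equiv.Perm (Fin n)} {k l : Fin n}
    (h : ∀ m, τ.SameCycle l m ↔ σ.SameCycle k m) : cycleSize τ l = cycleSize σ k := by
  simp only [cycleSize, h]

theorem cycleWord_congr {σ τ : Equiv.Perm (Fin n)} {k : Fin n}
    (h : ∀ m, σ.SameCycle k m → τ m = σ m) : cycleWord τ k = cycleWord σ k := by
  rw [cycleWord_eq_iterate, cycleWord_eq_iterate, cycleSize_congr (sameCycle_congr h),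
    ← List.range_map_iterate, ← List.range_map_iterate]
  exact List.map_congr_left fun a _ => iterate_congr_of_sameCycle h a

/-- An orbit of `τ` stays in an orbit of `σ` as soon as `τ` moves points within orbits of `σ`. -/
theorem sameCycle_of_forall_sameCycle {σ τ : Equiv.Perm (Fin n)}
    (h : ∀ m, σ.SameCycle m (τ m)) {k m : Fin n} (hm : τ.SameCycle k m) : σ.SameCycle k m := by
  obtain ⟨a, rfl⟩ := exists_iterate_eq hm
  clear hm
  induction a with
  | zero => exact Equiv.Perm.SameCycle.refl _ _
  | succ a ih =>
    rw [Function.iterate_succ_apply']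
    exact ih.trans (h _)

/-! ### Reversing a cycle -/

/-- The permutation obtained from `σ` by reversing the cycle through `k`. -/
def reverseCycle (σ : Equiv.Perm (Fin n)) (k : Fin n) : Equiv.Perm (Fin n) :=
  σ * (σ.cycleOf k)⁻¹ * (σ.cycleOf k)⁻¹

theorem sign_reverseCycle (σ : Equiv.Perm (Fin n)) (k : Fin n) :
    Equiv.Perm.sign (reverseCycle σ k) = Equiv.Perm.sign σ := by
  rw [reverseCycle, map_mul, map_mul, mul_assoc, Int.units_mul_self, mul_one]

theorem reverseCycle_apply_of_sameCycle {σ : Equiv.Perm (Fin n)} {k m : Fin n}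
    (h : σ.SameCycle k m) : reverseCycle σ k m = σ.symm m := by
  have h1 : (σ.cycleOf k)⁻¹ m = σ.symm m := by
    rw [Equiv.Perm.cycleOf_inv, Equiv.Perm.cycleOf_apply, if_pos (Equiv.Perm.sameCycle_inv.2 h)]
    rfl
  have h2 : (σ.cycleOf k)⁻¹ (σ.symm m) = σ.symm (σ.symm m) := by
    rw [Equiv.Perm.cycleOf_inv, Equiv.Perm.cycleOf_apply,
      if_pos (Equiv.Perm.sameCycle_inv.2 (Equiv.Perm.sameCycle_symm_apply_right.2 h))]
    rfl
  rw [reverseCycle, Equiv.Perm.mul_apply, Equiv.Perm.mul_apply, h1, h2, Equiv.apply_symm_apply]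

theorem reverseCycle_apply_of_not_sameCycle {σ : Equiv.Perm (Fin n)} {k m : Fin n}
    (h : ¬ σ.SameCycle k m) : reverseCycle σ k m = σ m := by
  have h1 : (σ.cycleOf k)⁻¹ m = m := by
    rw [Equiv.Perm.cycleOf_inv, Equiv.Perm.cycleOf_apply,
      if_neg fun H => h (Equiv.Perm.sameCycle_inv.1 H)]
  rw [reverseCycle, Equiv.Perm.mul_apply, Equiv.Perm.mul_apply, h1, h1]

theorem sameCycle_reverseCycle {σ : Equiv.Perm (Fin n)} {k a b : Fin n} :
    (reverseCycle σ k).SameCycle a b ↔ σ.SameCycle a b := by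
  constructor
  · refine sameCycle_of_forall_sameCycle fun m => ?_
    by_cases h : σ.SameCycle k m
    · rw [reverseCycle_apply_of_sameCycle h]
      exact Equiv.Perm.sameCycle_symm_apply_right.2 (Equiv.Perm.SameCycle.refl _ _)
    · rw [reverseCycle_apply_of_not_sameCycle h]
      exact Equiv.Perm.sameCycle_apply_right.2 (Equiv.Perm.SameCycle.refl _ _)
  · refine sameCycle_of_forall_sameCycle fun m => ?_
    by_cases h : σ.SameCycle k m
    · have h' : σ.SameCycle k (σ m) := Equiv.Perm.sameCycle_apply_right.2 h
      have := Equiv.Perm.sameCycle_apply_right.2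
        (Equiv.Perm.SameCycle.refl (reverseCycle σ k) (σ m))
      rw [reverseCycle_apply_of_sameCycle h', Equiv.symm_apply_apply] at this
      exact this.symm
    · rw [← reverseCycle_apply_of_not_sameCycle h]
      exact Equiv.Perm.sameCycle_apply_right.2 (Equiv.Perm.SameCycle.refl _ _)

theorem reverseCycle_involutive (k : Fin n) :
    Function.Involutive fun σ : Equiv.Perm (Fin n) => reverseCycle σ k := by
  intro σ
  ext1 m
  by_cases h : σ.SameCycle k m
  · have h' : σ.SameCycle k (σ m) := Equiv.Perm.sameCycle_apply_right.2 h
    simp only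
    rw [reverseCycle_apply_of_sameCycle (sameCycle_reverseCycle.2 h), Equiv.symm_apply_eq,
      reverseCycle_apply_of_sameCycle h', Equiv.symm_apply_apply]
  · simp only
    rw [reverseCycle_apply_of_not_sameCycle (mt sameCycle_reverseCycle.1 h),
      reverseCycle_apply_of_not_sameCycle h]

theorem sum_reverseCycle {R : Type*} [AddCommMonoid R] (k : Fin n)
    (f : Equiv.Perm (Fin n) → R) : ∑ σ, f (reverseCycle σ k) = ∑ σ, f σ :=
  (reverseCycle_involutive k).bijective.sum_comp f

theorem cycleHeads_reverseCycle (σ : Equiv.Perm (Fin n)) (k i : Fin n) :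
    cycleHeads (reverseCycle σ k) i = cycleHeads σ i := by
  simp only [cycleHeads, sameCycle_reverseCycle]

/-! ### Products along cycles -/

/-- The product of the entries of `M` along the cycle of `σ` through `k`, starting at `k`. -/
def cycleProd {R : Type*} [Monoid R] (M : Matrix (Fin n) (Fin n) R) (σ : Equiv.Perm (Fin n))
    (k : Fin n) : R :=
  ((cycleWord σ k).map fun j => M j (σ j)).prod

section Path

variable {R : Type*} [Monoid R]

/-- The product of the entries of `M` along the first `N` steps of the orbit of `k`. -/
def pathProd (M : Matrix (Fin n) (Fin n) R) (σ : Equiv.Perm (Fin n)) (k : Fin n) (N : ℕ) : R :=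
  ((List.iterate σ k N).map fun j => M j (σ j)).prod

theorem cycleProd_eq_pathProd (M : Matrix (Fin n) (Fin n) R) (σ : Equiv.Perm (Fin n))
    (k : Fin n) : cycleProd M σ k = pathProd M σ k (cycleSize σ k) := rfl

theorem pathProd_succ (M : Matrix (Fin n) (Fin n) R) (σ : Equiv.Perm (Fin n)) (k : Fin n)
    (N : ℕ) : pathProd M σ k (N + 1) = M k (σ k) * pathProd M σ (σ k) N := by
  simp [pathProd, List.iterate]

theorem pathProd_add (M : Matrix (Fin n) (Fin n) R) (σ : Equiv.Perm (Fin n)) (k : Fin n)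
    (N N' : ℕ) :
    pathProd M σ k (N + N') = pathProd M σ k N * pathProd M σ (σ^[N] k) N' := by
  rw [pathProd, List.iterate_add, List.map_append, List.prod_append]
  rfl

theorem pathProd_succ' (M : Matrix (Fin n) (Fin n) R) (σ : Equiv.Perm (Fin n)) (k : Fin n)
    (N : ℕ) :
    pathProd M σ k (N + 1) = pathProd M σ k N * M (σ^[N] k) (σ (σ^[N] k)) := by
  rw [pathProd_add]
  simp [pathProd, List.iterate]

/-- The path product depends only on the entries met along the path. -/
theorem pathProd_congr {M M' : Matrix (Fin n) (Fin n) R} {σ σ' : Equiv.Perm (Fin n)}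
    {k k' : Fin n} {N : ℕ}
    (h : ∀ a < N, M (σ^[a] k) (σ^[a + 1] k) = M' (σ'^[a] k') (σ'^[a + 1] k')) :
    pathProd M σ k N = pathProd M' σ' k' N := by
  induction N with
  | zero => rfl
  | succ N ih =>
    rw [pathProd_succ', pathProd_succ', ih fun a ha => h a (by omega)]
    have := h N (by omega)
    rw [Function.iterate_succ_apply', Function.iterate_succ_apply'] at this
    rw [this]

theorem star_pathProd [StarMul R] (M : Matrix (Fin n) (Fin n) R) (σ : Equiv.Perm (Fin n))
    (k : Fin n) (N : ℕ) :
    star (pathProd M σ k N) = pathProd Mᴴ σ⁻¹ (σ^[N] k) N := by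
  induction N with
  | zero => simp [pathProd, List.iterate]
  | succ N ih =>
    rw [pathProd_succ', star_mul, ih, pathProd_succ, Function.iterate_succ_apply',
      Equiv.Perm.coe_inv, Equiv.symm_apply_apply, Matrix.conjTranspose_apply]

end Path

theorem cycleProd_congr {R : Type*} [Monoid R] {M M' : Matrix (Fin n) (Fin n) R}
    {σ τ : Equiv.Perm (Fin n)} {k : Fin n} (h : ∀ m, σ.SameCycle k m → τ m = σ m)
    (hM : ∀ m, σ.SameCycle k m → M' m (σ m) = M m (σ m)) :
    cycleProd M' τ k = cycleProd M σ k := by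
  rw [cycleProd, cycleProd, cycleWord_congr h]
  congr 1
  refine List.map_congr_left fun m hm => ?_
  have hm' := sameCycle_of_mem_cycleWord hm
  rw [h m hm', hM m hm']

theorem star_cycleProd {R : Type*} [Monoid R] [StarMul R] (M : Matrix (Fin n) (Fin n) R)
    (σ : Equiv.Perm (Fin n)) (k : Fin n) :
    star (cycleProd M σ k) = cycleProd Mᴴ σ⁻¹ k := by
  rw [cycleProd_eq_pathProd, star_pathProd, iterate_cycleSize, cycleProd_eq_pathProd,
    cycleSize_congr fun m => Equiv.Perm.sameCycle_inv]

theorem cycleProd_reverseCycle {R : Type*} [Monoid R] [StarMul R]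
    {M : Matrix (Fin n) (Fin n) R} {σ : Equiv.Perm (Fin n)} {k : Fin n}
    (hM : ∀ a b, σ.SameCycle k a → σ.SameCycle k b → star (M a b) = M b a) :
    cycleProd M (reverseCycle σ k) k = star (cycleProd M σ k) := by
  rw [star_cycleProd]
  refine cycleProd_congr (fun m hm => reverseCycle_apply_of_sameCycle
    (Equiv.Perm.sameCycle_inv.1 hm)) fun m hm => ?_
  rw [Equiv.Perm.sameCycle_inv] at hm
  rw [Matrix.conjTranspose_apply, Equiv.Perm.coe_inv,
    hM _ _ (Equiv.Perm.sameCycle_symm_apply_right.2 hm) hm]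

theorem cycleProd_reverseCycle_of_not_sameCycle {R : Type*} [Monoid R]
    (M : Matrix (Fin n) (Fin n) R) {σ : Equiv.Perm (Fin n)} {k m : Fin n}
    (h : ¬ σ.SameCycle k m) :
    cycleProd M (reverseCycle σ k) m = cycleProd M σ m :=
  cycleProd_congr (fun _ ha => reverseCycle_apply_of_not_sameCycle
    fun hb => h (hb.trans ha.symm)) fun _ _ => rfl

theorem Quaternion.re_mul_comm (a b : ℍ[ℝ]) : (a * b).re = (b * a).re := by
  rw [Quaternion.re_mul, Quaternion.re_mul]; ring

/-- The real part of a cyclic product does not depend on where the cycle is opened. -/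
theorem re_cycleProd_eq_of_sameCycle (M : Matrix (Fin n) (Fin n) ℍ[ℝ])
    {σ : Equiv.Perm (Fin n)} {k m : Fin n} (h : σ.SameCycle k m) :
    (cycleProd M σ m).re = (cycleProd M σ k).re := by
  have step (k : Fin n) : (cycleProd M σ (σ k)).re = (cycleProd M σ k).re := by
    have hsize : cycleSize σ (σ k) = cycleSize σ k :=
      cycleSize_congr fun m => Equiv.Perm.sameCycle_apply_left
    rw [cycleProd_eq_pathProd, cycleProd_eq_pathProd, hsize]
    have hk := iterate_cycleSize σ k
    obtain ⟨N, hN⟩ := Nat.exists_eq_succ_of_ne_zero (cycleSize_pos σ k).ne'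
    rw [hN, Function.iterate_succ_apply] at hk
    rw [hN, Nat.succ_eq_add_one, pathProd_succ M σ k, pathProd_succ', hk,
      Quaternion.re_mul_comm]
  obtain ⟨a, rfl⟩ := exists_iterate_eq h
  clear h
  induction a with
  | zero => rfl
  | succ a ih => rw [Function.iterate_succ_apply', step, ih]

end Cycles

/-! ### Row determinants as sums over cycle products -/

section RowDet

variable {n : ℕ}

theorem rdet_eq_sum_cycleProd {R : Type*} [Ring R] (i : Fin n) (M : Matrix (Fin n) (Fin n) R) :
    rdet i M = ∑ σ : Equiv.Perm (Fin n),
      Equiv.Perm.sign σ • ((cycleHeads σ i).map (cycleProd M σ)).prod := by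
  refine Finset.sum_congr rfl fun σ _ => ?_
  rw [leftOrderedWord, List.map_flatMap, List.flatMap_def, List.prod_flatten, List.map_map]
  rfl

theorem mem_cycleHeads {σ : Equiv.Perm (Fin n)} {i m : Fin n} :
    m ∈ cycleHeads σ i ↔
      m = i ∨ ¬ σ.SameCycle i m ∧ ∀ j, σ.SameCycle m j → m ≤ j := by
  simp [cycleHeads]

theorem nodup_cycleHeads (σ : Equiv.Perm (Fin n)) (i : Fin n) : (cycleHeads σ i).Nodup := by
  rw [cycleHeads, List.nodup_cons]
  refine ⟨fun h => ?_, (List.nodup_finRange n).filter _⟩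
  simp only [List.mem_filter, decide_eq_true_eq] at h
  exact h.2.1 (Equiv.Perm.SameCycle.refl _ _)

/-- Distinct heads lie on distinct cycles. -/
theorem not_sameCycle_of_mem_cycleHeads {σ : Equiv.Perm (Fin n)} {i a b : Fin n}
    (ha : a ∈ cycleHeads σ i) (hb : b ∈ cycleHeads σ i) (hab : a ≠ b) : ¬ σ.SameCycle a b := by
  intro h
  rw [mem_cycleHeads] at ha hb
  rcases ha with rfl | ⟨ha, ha'⟩ <;> rcases hb with rfl | ⟨hb, hb'⟩
  · exact hab rfl
  · exact hb h
  · exact ha h.symm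
  · exact hab (le_antisymm (ha' b h) (hb' a h.symm))

/-- The word of the `i`-th row determinant begins with `i`, which occurs nowhere else in it. -/
theorem exists_leftOrderedWord_eq_cons (σ : Equiv.Perm (Fin n)) (i : Fin n) :
    ∃ l, leftOrderedWord σ i = i :: l ∧ i ∉ l := by
  refine ⟨(cycleWord σ i).tail ++ ((List.finRange n).filter fun m =>
    ¬ σ.SameCycle i m ∧ ∀ j, σ.SameCycle m j → m ≤ j).flatMap (cycleWord σ), ?_, ?_⟩
  · rw [leftOrderedWord, cycleHeads, List.flatMap_cons]
    conv_lhs => rw [cycleWord_eq_cons σ i]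
    rfl
  · simp only [List.mem_append, List.mem_flatMap, List.mem_filter, decide_eq_true_eq, not_or,
      not_exists, not_and]
    exact ⟨notMem_tail_cycleWord σ i, fun m hm hi =>
      hm.2.1 (sameCycle_of_mem_cycleWord hi).symm⟩

/-- The `i`-th row determinant is left linear in the `i`-th row. -/
theorem rdet_updateRow_vecMul {R : Type*} [Ring R] (i : Fin n) (M V : Matrix (Fin n) (Fin n) R)
    (x : Fin n → R) :
    rdet i (M.updateRow i (x ᵥ* V)) = ∑ k, x k * rdet i (M.updateRow i (V k)) := by
  simp only [rdet, Finset.mul_sum]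
  rw [Finset.sum_comm]
  refine Finset.sum_congr rfl fun σ _ => ?_
  obtain ⟨l, hl, hi⟩ := exists_leftOrderedWord_eq_cons σ i
  have hrest (v : Fin n → R) : (l.map fun k => M.updateRow i v k (σ k)) =
      l.map fun k => M k (σ k) :=
    List.map_congr_left fun k hk => by
      rw [Matrix.updateRow_ne fun h => hi (by rwa [h] at hk)]
  simp only [hl, List.map_cons, List.prod_cons, hrest, Matrix.updateRow_self, Matrix.vecMul,
    dotProduct, Finset.sum_mul, Finset.smul_sum, mul_smul_comm, mul_assoc]

/-! ### Averaging over the orientations of the cycles -/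

/-- Reversing the cycle opened by `m` conjugates its factor and leaves the other factors alone,
so that in the sum over all permutations this factor may be replaced by its real part. -/
theorem sum_prod_cycleHeads_insert (i m : Fin n) (M : Matrix (Fin n) (Fin n) ℍ[ℝ])
    (hM : ∀ σ : Equiv.Perm (Fin n), m ∈ cycleHeads σ i →
      ∀ a b, σ.SameCycle m a → σ.SameCycle m b → star (M a b) = M b a)
    (t : Finset (Fin n)) (hm : m ∉ t) :
    ∑ σ : Equiv.Perm (Fin n), Equiv.Perm.sign σ • ((cycleHeads σ i).map fun k =>
        if k ∈ t then ((cycleProd M σ k).re : ℍ[ℝ]) else cycleProd M σ k).prod =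
      ∑ σ : Equiv.Perm (Fin n), Equiv.Perm.sign σ • ((cycleHeads σ i).map fun k =>
        if k ∈ insert m t then ((cycleProd M σ k).re : ℍ[ℝ]) else cycleProd M σ k).prod := by
  have := IsAddTorsionFree.of_module_rat ℍ[ℝ]
  rw [← sub_eq_zero, ← Finset.sum_sub_distrib, ← self_eq_neg, ← Finset.sum_neg_distrib]
  conv_lhs => rw [← sum_reverseCycle m]
  refine Finset.sum_congr rfl fun σ _ => ?_
  rw [sign_reverseCycle, cycleHeads_reverseCycle, ← smul_sub, ← smul_sub, ← smul_neg]
  congr 1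
  by_cases hmem : m ∈ cycleHeads σ i
  · obtain ⟨l₁, l₂, hl⟩ := List.append_of_mem hmem
    have hnd := nodup_cycleHeads σ i
    rw [hl] at hnd
    have hne : ∀ k, k ∈ l₁ ∨ k ∈ l₂ → k ≠ m := by
      rintro k hk rfl
      rw [List.nodup_append, List.nodup_cons] at hnd
      rcases hk with hk | hk
      · exact hnd.2.2 k hk k List.mem_cons_self rfl
      · exact hnd.2.1.1 hk
    have hother : ∀ k, k ∈ l₁ ∨ k ∈ l₂ →
        cycleProd M (reverseCycle σ m) k = cycleProd M σ k := fun k hk =>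
      cycleProd_reverseCycle_of_not_sameCycle M <| not_sameCycle_of_mem_cycleHeads hmem
        (by rw [hl]; simp [hk.imp_right Or.inr]) (hne k hk).symm
    have hmap (l : List (Fin n)) (h : ∀ k ∈ l, k ∈ l₁ ∨ k ∈ l₂) (τ : Equiv.Perm (Fin n))
        (s : Finset (Fin n)) (hτ : τ = σ ∨ τ = reverseCycle σ m) (hs : s = t ∨ s = insert m t) :
        (l.map fun k => if k ∈ s then ((cycleProd M τ k).re : ℍ[ℝ]) else cycleProd M τ k) =
        l.map fun k => if k ∈ t then ((cycleProd M σ k).re : ℍ[ℝ]) else cycleProd M σ k := by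
      refine List.map_congr_left fun k hk => ?_
      have h1 : cycleProd M τ k = cycleProd M σ k := by
        rcases hτ with rfl | rfl
        · rfl
        · exact hother k (h k hk)
      have h2 : k ∈ s ↔ k ∈ t := by
        rcases hs with rfl | rfl
        · rfl
        · rw [Finset.mem_insert, or_iff_right (hne k (h k hk))]
      simp only [h1, h2]
    have hl₁ := hmap l₁ fun k hk => Or.inl hk
    have hl₂ := hmap l₂ fun k hk => Or.inr hk
    simp only [hl, List.map_append, List.map_cons, List.prod_append, List.prod_cons]
    rw [hl₁ _ t (Or.inl rfl) (Or.inl rfl), hl₁ _ (insert m t) (Or.inl rfl) (Or.inr rfl),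
      hl₁ _ t (Or.inr rfl) (Or.inl rfl), hl₁ _ (insert m t) (Or.inr rfl) (Or.inr rfl),
      hl₂ _ t (Or.inl rfl) (Or.inl rfl), hl₂ _ (insert m t) (Or.inl rfl) (Or.inr rfl),
      hl₂ _ t (Or.inr rfl) (Or.inl rfl), hl₂ _ (insert m t) (Or.inr rfl) (Or.inr rfl),
      if_neg hm, if_neg hm, if_pos (Finset.mem_insert_self _ _),
      if_pos (Finset.mem_insert_self _ _), cycleProd_reverseCycle (hM σ hmem), Quaternion.re_star,
      ← mul_sub, ← sub_mul, ← mul_sub, ← sub_mul, ← mul_neg, ← neg_mul, neg_sub]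
    congr 2
    rw [sub_eq_sub_iff_add_eq_add, Quaternion.star_add_self', two_mul, Quaternion.coe_add]
  · have hmap (τ : Equiv.Perm (Fin n)) :
        ((cycleHeads σ i).map fun k =>
          if k ∈ insert m t then ((cycleProd M τ k).re : ℍ[ℝ]) else cycleProd M τ k) =
        (cycleHeads σ i).map fun k =>
          if k ∈ t then ((cycleProd M τ k).re : ℍ[ℝ]) else cycleProd M τ k := by
      refine List.map_congr_left fun k hk => ?_
      have : k ≠ m := fun h => hmem (h ▸ hk)
      simp only [Finset.mem_insert, or_iff_right this]
    rw [hmap, hmap, sub_self, sub_self, neg_zero]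

/-- The factors of all heads in `t` may be replaced by their real parts. -/
theorem rdet_eq_sum_re (i : Fin n) (M : Matrix (Fin n) (Fin n) ℍ[ℝ]) (t : Finset (Fin n))
    (hM : ∀ m ∈ t, ∀ σ : Equiv.Perm (Fin n), m ∈ cycleHeads σ i →
      ∀ a b, σ.SameCycle m a → σ.SameCycle m b → star (M a b) = M b a) :
    rdet i M = ∑ σ : Equiv.Perm (Fin n), Equiv.Perm.sign σ • ((cycleHeads σ i).map fun k =>
        if k ∈ t then ((cycleProd M σ k).re : ℍ[ℝ]) else cycleProd M σ k).prod := by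
  induction t using Finset.induction_on with
  | empty => simpa using! rdet_eq_sum_cycleProd i M
  | insert m t hm ih =>
    rw [ih fun k hk => hM k (Finset.mem_insert_of_mem hk),
      sum_prod_cycleHeads_insert i m M (hM m (Finset.mem_insert_self _ _)) t hm]

/-- The least elements of the cycles of `σ`. -/
def leaders (σ : Equiv.Perm (Fin n)) : Finset (Fin n) :=
  Finset.univ.filter fun m => ∀ j, σ.SameCycle m j → m ≤ j

/-- The least elements of those cycles of `σ` that do not contain `i`. -/
def otherLeaders (σ : Equiv.Perm (Fin n)) (i : Fin n) : Finset (Fin n) :=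
  (leaders σ).filter fun m => ¬ σ.SameCycle i m

theorem prod_map_filter_finRange_coe (i : Fin n) (σ : Equiv.Perm (Fin n)) (g : Fin n → ℝ) :
    (((List.finRange n).filter fun m =>
      ¬ σ.SameCycle i m ∧ ∀ j, σ.SameCycle m j → m ≤ j).map fun k => (g k : ℍ[ℝ])).prod =
    ((∏ m ∈ otherLeaders σ i, g m : ℝ) : ℍ[ℝ]) := by
  have h : otherLeaders σ i = ((List.finRange n).filter fun m =>
      ¬ σ.SameCycle i m ∧ ∀ j, σ.SameCycle m j → m ≤ j).toFinset := by
    ext m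
    simp [otherLeaders, leaders, and_comm]
  rw [h, List.prod_toFinset _ ((List.nodup_finRange n).filter _), ← Quaternion.algebraMap_def,
    map_list_prod, List.map_map]
  rfl

/-- If `M` is Hermitian apart from its `i`-th row and column, then in the `i`-th row determinant
the product along every cycle that avoids `i` may be replaced by its real part. -/
theorem rdet_eq_sum_cycleProd_mul_re {i : Fin n} {M : Matrix (Fin n) (Fin n) ℍ[ℝ]}
    (hM : ∀ a b, a ≠ i → b ≠ i → star (M a b) = M b a) :
    rdet i M = ∑ σ : Equiv.Perm (Fin n), Equiv.Perm.sign σ •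
      (cycleProd M σ i * ((∏ m ∈ otherLeaders σ i, (cycleProd M σ m).re : ℝ) : ℍ[ℝ])) := by
  rw [rdet_eq_sum_re i M (Finset.univ.erase i)]
  · refine Finset.sum_congr rfl fun σ _ => ?_
    rw [cycleHeads, List.map_cons, List.prod_cons, if_neg (Finset.notMem_erase _ _),
      ← prod_map_filter_finRange_coe]
    congr 3
    refine List.map_congr_left fun k hk => ?_
    simp only [List.mem_filter, decide_eq_true_eq] at hk
    rw [if_pos]
    rw [Finset.mem_erase]
    exact ⟨fun h => hk.2.1 (h ▸ Equiv.Perm.SameCycle.refl _ _), Finset.mem_univ _⟩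
  · intro m hm σ hσ a b ha hb
    have hmi : ¬ σ.SameCycle m i := not_sameCycle_of_mem_cycleHeads hσ
      (mem_cycleHeads.2 (Or.inl rfl)) (Finset.ne_of_mem_erase hm)
    exact hM a b (fun h => hmi (h ▸ ha)) (fun h => hmi (h ▸ hb))

/-- The determinant of a Hermitian matrix in its symmetric form: the alternating sum over all
permutations of the products, over all cycles, of the real parts of the cyclic products. -/
noncomputable def hermitianDet (M : Matrix (Fin n) (Fin n) ℍ[ℝ]) : ℝ :=
  ∑ σ : Equiv.Perm (Fin n), Equiv.Perm.sign σ • ∏ m ∈ leaders σ, (cycleProd M σ m).re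

/-- The cycle through `i` contributes the same factor whether it is opened at `i` or at its
least element. -/
theorem re_cycleProd_mul_prod_leaders (M : Matrix (Fin n) (Fin n) ℍ[ℝ])
    (σ : Equiv.Perm (Fin n)) (i : Fin n) (s : Finset (Fin n)) (hs : s ⊆ leaders σ)
    (hi : ∀ m ∈ leaders σ, σ.SameCycle i m → m ∈ s) :
    (cycleProd M σ i).re * ∏ m ∈ s with ¬ σ.SameCycle i m, (cycleProd M σ m).re =
      ∏ m ∈ s, (cycleProd M σ m).re := by
  obtain ⟨l, hl, hmin⟩ := Finset.exists_min_image
    (Finset.univ.filter fun m => σ.SameCycle i m) id ⟨i, by simp [Equiv.Perm.SameCycle.refl]⟩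
  simp only [Finset.mem_filter, Finset.mem_univ, true_and, id] at hl hmin
  have hlmem : l ∉ s.filter fun m => ¬ σ.SameCycle i m := by simp [hl]
  have hset : s = insert l (s.filter fun m => ¬ σ.SameCycle i m) := by
    ext m
    simp only [Finset.mem_filter, Finset.mem_insert]
    constructor
    · intro h
      by_cases him : σ.SameCycle i m
      · have hm := hs h
        simp only [leaders, Finset.mem_filter, Finset.mem_univ, true_and] at hm
        exact Or.inl (le_antisymm (hm l (him.symm.trans hl)) (hmin m him))
      · exact Or.inr ⟨h, him⟩
    · rintro (rfl | h)
      · exact hi _ (by simpa [leaders] using fun j hj => hmin j (hl.trans hj)) hl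
      · exact h.1
  conv_rhs => rw [hset, Finset.prod_insert hlmem, re_cycleProd_eq_of_sameCycle M hl]

theorem Quaternion.coe_units_smul (u : ℤˣ) (x : ℝ) : ((u • x : ℝ) : ℍ[ℝ]) = u • (x : ℍ[ℝ]) := by
  rcases Int.units_eq_one_or u with rfl | rfl <;> simp

theorem Quaternion.coe_finset_sum {ι : Type*} (s : Finset ι) (f : ι → ℝ) :
    ((∑ x ∈ s, f x : ℝ) : ℍ[ℝ]) = ∑ x ∈ s, (f x : ℍ[ℝ]) := by
  simp only [← Quaternion.algebraMap_def, map_sum]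

/-- All row determinants of a Hermitian matrix are equal and real. -/
theorem rdet_eq_hermitianDet {M : Matrix (Fin n) (Fin n) ℍ[ℝ]} (hM : M.IsHermitian)
    (i : Fin n) : rdet i M = (hermitianDet M : ℍ[ℝ]) := by
  rw [rdet_eq_sum_re i M Finset.univ fun _ _ _ _ a b _ _ => hM.apply b a, hermitianDet,
    Quaternion.coe_finset_sum]
  refine Finset.sum_congr rfl fun σ _ => ?_
  simp only [Finset.mem_univ, if_true]
  rw [Quaternion.coe_units_smul, ← re_cycleProd_mul_prod_leaders M σ i _ subset_rfl fun _ h _ => h,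
    cycleHeads,
    List.map_cons, List.prod_cons, Quaternion.coe_mul,
    prod_map_filter_finRange_coe, otherLeaders]

/-- Inverting every permutation in the sum conjugates the row determinant. -/
theorem star_rdet {i : Fin n} {M : Matrix (Fin n) (Fin n) ℍ[ℝ]}
    (hM : ∀ a b, a ≠ i → b ≠ i → star (M a b) = M b a) : star (rdet i M) = rdet i Mᴴ := by
  rw [rdet_eq_sum_cycleProd_mul_re hM, rdet_eq_sum_cycleProd_mul_re (M := Mᴴ) (i := i)
    fun a b ha hb => by
      rw [Matrix.conjTranspose_apply, Matrix.conjTranspose_apply, hM b a hb ha],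
    star_sum]
  conv_rhs => rw [← Equiv.sum_comp (Equiv.inv (Equiv.Perm (Fin n)))]
  refine Finset.sum_congr rfl fun σ _ => ?_
  have hlead : otherLeaders σ⁻¹ i = otherLeaders σ i := by
    simp only [otherLeaders, leaders, Equiv.Perm.sameCycle_inv]
  rw [Equiv.inv_apply, Equiv.Perm.sign_inv, hlead]
  simp only [← star_cycleProd, Quaternion.re_star]
  rw [Units.smul_def, Units.smul_def, star_zsmul, star_mul, Quaternion.star_coe,
    Quaternion.coe_commutes]

end RowDet

/-! ### Joining two cycles by a transposition -/

section Join

variable {n : ℕ}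

theorem mul_swap_apply_of_ne {σ : Equiv.Perm (Fin n)} {i k m : Fin n} (hi : m ≠ i)
    (hk : m ≠ k) : (σ * Equiv.swap i k) m = σ m := by
  rw [Equiv.Perm.mul_apply, Equiv.swap_apply_of_ne_of_ne hi hk]

/-- After multiplication by the transposition of `i` and `k`, the orbit of `i` first runs
through the cycle of `k`. -/
theorem iterate_mul_swap {σ : Equiv.Perm (Fin n)} {i k : Fin n} (h : ¬ σ.SameCycle i k) {a : ℕ}
    (ha : a < cycleSize σ k) : (σ * Equiv.swap i k)^[a + 1] i = σ^[a + 1] k := by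
  induction a with
  | zero => simp
  | succ a ih =>
    rw [Function.iterate_succ_apply', ih (by omega), Function.iterate_succ_apply' _ (a + 1)]
    refine mul_swap_apply_of_ne ?_ (iterate_ne_of_lt_cycleSize (by omega) ha)
    rintro h'
    exact h (h' ▸ (sameCycle_iterate σ k (a + 1)).symm)

theorem iterate_cycleSize_mul_swap {σ : Equiv.Perm (Fin n)} {i k : Fin n}
    (h : ¬ σ.SameCycle i k) : (σ * Equiv.swap i k)^[cycleSize σ k] i = k := by
  obtain ⟨N, hN⟩ := Nat.exists_eq_succ_of_ne_zero (cycleSize_pos σ k).ne'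
  have hk := iterate_cycleSize σ k
  rw [hN] at hk ⊢
  rw [Nat.succ_eq_add_one, iterate_mul_swap h (by omega)]
  exact hk

theorem mul_swap_apply_of_not_sameCycle {σ : Equiv.Perm (Fin n)} {i k m : Fin n}
    (hi : ¬ σ.SameCycle i m) (hk : ¬ σ.SameCycle k m) {l : Fin n} (hl : σ.SameCycle m l) :
    (σ * Equiv.swap i k) l = σ l :=
  mul_swap_apply_of_ne (fun H => hi (H ▸ hl.symm)) (fun H => hk (H ▸ hl.symm))

/-- Multiplication by the transposition of two points on different cycles joins these cycles. -/
theorem sameCycle_mul_swap_iff {σ : Equiv.Perm (Fin n)} {i k m : Fin n}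
    (h : ¬ σ.SameCycle i k) :
    (σ * Equiv.swap i k).SameCycle i m ↔ σ.SameCycle i m ∨ σ.SameCycle k m := by
  have hik : (σ * Equiv.swap i k).SameCycle i k := by
    have := sameCycle_iterate (σ * Equiv.swap i k) i (cycleSize σ k)
    rwa [iterate_cycleSize_mul_swap h] at this
  have key {i k : Fin n} (h : ¬ σ.SameCycle i k) {m : Fin n} (hm : σ.SameCycle k m)
      (hik : (σ * Equiv.swap i k).SameCycle i k) :
      (σ * Equiv.swap i k).SameCycle i m := by
    obtain ⟨a, rfl⟩ := exists_iterate_eq hm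
    rw [← Function.IsPeriodicPt.iterate_mod_apply (iterate_cycleSize σ k) a]
    have hlt := Nat.mod_lt a (cycleSize_pos σ k)
    rcases hb : a % cycleSize σ k with _ | b
    · exact hik
    · rw [← iterate_mul_swap h (by omega)]
      exact sameCycle_iterate _ _ _
  constructor
  · intro hm
    by_contra! hcon
    have := (sameCycle_congr (σ := σ) (τ := σ * Equiv.swap i k) (k := m)
      (fun _ hl => mul_swap_apply_of_not_sameCycle hcon.1 hcon.2 hl) i).1 hm.symm
    exact hcon.1 this.symm
  · rintro (hm | hm)
    · have := key (i := k) (k := i) (fun H => h H.symm) hm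
        (by rw [Equiv.swap_comm]; exact hik.symm)
      rw [Equiv.swap_comm] at this
      exact hik.trans this
    · exact key h hm hik

/-- Multiplication by the transposition of two points of one cycle splits this cycle. -/
theorem not_sameCycle_mul_swap {σ : Equiv.Perm (Fin n)} {i k : Fin n} (hik : i ≠ k)
    (h : σ.SameCycle i k) : ¬ (σ * Equiv.swap i k).SameCycle i k := by
  classical
  have hex : ∃ a, σ^[a] i = k := exists_iterate_eq h
  obtain ⟨a, ha, hmin⟩ : ∃ a, σ^[a] i = k ∧ ∀ b < a, σ^[b] i ≠ k :=
    ⟨Nat.find hex, Nat.find_spec hex, fun b hb => Nat.find_min hex hb⟩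
  have hpos : 0 < a := by
    rcases Nat.eq_zero_or_pos a with rfl | h0
    · exact absurd ha hik
    · exact h0
  have hlt : a < cycleSize σ i := by
    by_contra! hle
    refine hmin (a % cycleSize σ i) ((Nat.mod_lt a (cycleSize_pos σ i)).trans_le hle) ?_
    rw [Function.IsPeriodicPt.iterate_mod_apply (iterate_cycleSize σ i) a, ha]
  have hit (b : ℕ) (hb : b < a) : (σ * Equiv.swap i k)^[b + 1] k = σ^[b + 1] i := by
    induction b with
    | zero => simp
    | succ b ih =>
      rw [Function.iterate_succ_apply', ih (by omega), Function.iterate_succ_apply' _ (b + 1)]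
      exact mul_swap_apply_of_ne (iterate_ne_of_lt_cycleSize (by omega) (by omega)) (hmin _ hb)
  have hper : Function.IsPeriodicPt (σ * Equiv.swap i k) a k := by
    obtain ⟨b, rfl⟩ := Nat.exists_eq_succ_of_ne_zero hpos.ne'
    exact (hit b (by omega)).trans ha
  intro hcon
  obtain ⟨c, hc⟩ := exists_iterate_eq hcon.symm
  rw [← hper.iterate_mod_apply c] at hc
  have hclt := Nat.mod_lt c hpos
  rcases hb : c % a with _ | b
  · rw [hb] at hc
    exact hik hc.symm
  · rw [hb, hit b (by omega)] at hc
    exact iterate_ne_of_lt_cycleSize (by omega) (by omega) hc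

theorem sameCycle_mul_swap_iff_not {σ : Equiv.Perm (Fin n)} {i k : Fin n} (hik : i ≠ k) :
    (σ * Equiv.swap i k).SameCycle i k ↔ ¬ σ.SameCycle i k :=
  ⟨fun h h' => not_sameCycle_mul_swap hik h' h,
    fun h => (sameCycle_mul_swap_iff h).2 (Or.inr (Equiv.Perm.SameCycle.refl _ _))⟩

theorem cycleSize_mul_swap {σ : Equiv.Perm (Fin n)} {i k : Fin n} (h : ¬ σ.SameCycle i k) :
    cycleSize (σ * Equiv.swap i k) i = cycleSize σ k + cycleSize σ i := by
  rw [cycleSize, cycleSize, cycleSize, ← Finset.card_union_of_disjoint, ← Finset.filter_or]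
  · simp only [sameCycle_mul_swap_iff h, or_comm]
  · refine Finset.disjoint_filter.2 fun m _ hk hi => h (hi.trans hk.symm)

/-- If the rows `i` and `k` of `M` agree, then the product along the joined cycle is the product
of those along the two separate cycles. -/
theorem cycleProd_mul_swap {R : Type*} [Monoid R] {M : Matrix (Fin n) (Fin n) R} {i k : Fin n}
    (hM : M i = M k) {σ : Equiv.Perm (Fin n)} (h : ¬ σ.SameCycle i k) :
    cycleProd M (σ * Equiv.swap i k) i = cycleProd M σ k * cycleProd M σ i := by
  have path {i k : Fin n} (hM : M i = M k) (h : ¬ σ.SameCycle i k) :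
      pathProd M (σ * Equiv.swap i k) i (cycleSize σ k) = pathProd M σ k (cycleSize σ k) := by
    refine pathProd_congr fun a ha => ?_
    rw [iterate_mul_swap h ha]
    rcases a with _ | a
    · rw [Function.iterate_zero_apply, Function.iterate_zero_apply, hM]
    · rw [iterate_mul_swap h (by omega)]
  rw [cycleProd_eq_pathProd, cycleSize_mul_swap h, pathProd_add, iterate_cycleSize_mul_swap h,
    path hM h, Equiv.swap_comm, path hM.symm fun H => h H.symm]
  rfl

/-- Joining the cycle of `k` to that of `i` removes the leader of the cycle of `k` and affects no
other leader outside the cycle of `i`. -/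
theorem otherLeaders_mul_swap {σ : Equiv.Perm (Fin n)} {i k : Fin n} (h : ¬ σ.SameCycle i k) :
    otherLeaders (σ * Equiv.swap i k) i =
      (otherLeaders σ i).filter fun m => ¬ σ.SameCycle k m := by
  ext m
  simp only [otherLeaders, leaders, Finset.mem_filter, Finset.mem_univ, true_and,
    sameCycle_mul_swap_iff h, not_or]
  by_cases hm : ¬ σ.SameCycle i m ∧ ¬ σ.SameCycle k m
  · have := sameCycle_congr (σ := σ) (τ := σ * Equiv.swap i k) (k := m)
      fun _ hl => mul_swap_apply_of_not_sameCycle hm.1 hm.2 hl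
    simp only [this]
    tauto
  · tauto

/-- Two equal rows make the `i`-th row determinant vanish, provided that the matrix is Hermitian
apart from its `i`-th row and column: the permutations for which `i` and `k` lie on one cycle
cancel those for which they do not. -/
theorem rdet_eq_zero_of_row_eq {i k : Fin n} (hik : i ≠ k) {M : Matrix (Fin n) (Fin n) ℍ[ℝ]}
    (hM : ∀ a b, a ≠ i → b ≠ i → star (M a b) = M b a) (hrow : M i = M k) : rdet i M = 0 := by
  have := IsAddTorsionFree.of_module_rat ℍ[ℝ]
  let f : Equiv.Perm (Fin n) → ℍ[ℝ] := fun σ => Equiv.Perm.sign σ •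
    (cycleProd M σ i * ((∏ m ∈ otherLeaders σ i, (cycleProd M σ m).re : ℝ) : ℍ[ℝ]))
  -- The part of the product that is common to `σ` and `σ * swap i k`.
  let d : Equiv.Perm (Fin n) → ℝ := fun σ =>
    ∏ m ∈ otherLeaders σ i with ¬ σ.SameCycle k m, (cycleProd M σ m).re
  let g : Equiv.Perm (Fin n) → ℍ[ℝ] := fun σ => if σ.SameCycle i k then 0 else
    Equiv.Perm.sign σ • (((cycleProd M σ k).re - cycleProd M σ k) * cycleProd M σ i * d σ)
  have hpair (σ : Equiv.Perm (Fin n)) (h : ¬ σ.SameCycle i k) :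
      f σ + f (σ * Equiv.swap i k) = g σ := by
    have h1 : ∏ m ∈ otherLeaders σ i, (cycleProd M σ m).re = (cycleProd M σ k).re * d σ := by
      refine (re_cycleProd_mul_prod_leaders M σ k _ (Finset.filter_subset _ _) ?_).symm
      exact fun m hm hkm => Finset.mem_filter.2 ⟨hm, fun him => h (him.trans hkm.symm)⟩
    have h2 : ∏ m ∈ otherLeaders (σ * Equiv.swap i k) i,
        (cycleProd M (σ * Equiv.swap i k) m).re = d σ := by
      rw [otherLeaders_mul_swap h]
      refine Finset.prod_congr rfl fun m hm => ?_
      simp only [otherLeaders, Finset.mem_filter] at hm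
      rw [cycleProd_congr (σ := σ)
        (fun _ hl => mul_swap_apply_of_not_sameCycle hm.1.2 hm.2 hl) fun _ _ => rfl]
    simp only [f, g, if_neg h]
    rw [h1, h2, cycleProd_mul_swap hrow h, Equiv.Perm.sign_mul, Equiv.Perm.sign_swap hik,
      mul_neg_one, Units.neg_smul, ← sub_eq_add_neg, ← smul_sub, Quaternion.coe_mul,
      ← mul_assoc, ← Quaternion.coe_commutes (cycleProd M σ k).re, sub_mul, sub_mul]
  have hrev (σ : Equiv.Perm (Fin n)) : g (reverseCycle σ k) = -g σ := by
    by_cases h : σ.SameCycle i k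
    · simp only [g, sameCycle_reverseCycle, if_pos h, neg_zero]
    · have h1 : d (reverseCycle σ k) = d σ := by
        simp only [d, otherLeaders, leaders, sameCycle_reverseCycle]
        refine Finset.prod_congr rfl fun m hm => ?_
        rw [cycleProd_reverseCycle_of_not_sameCycle M (Finset.mem_filter.1 hm).2]
      have h2 : cycleProd M (reverseCycle σ k) k = star (cycleProd M σ k) :=
        cycleProd_reverseCycle fun a b ha hb => hM a b
          (fun H => h (H ▸ ha.symm)) (fun H => h (H ▸ hb.symm))
      simp only [g, sameCycle_reverseCycle, if_neg h]
      rw [sign_reverseCycle, h1, h2, Quaternion.re_star,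
        cycleProd_reverseCycle_of_not_sameCycle M fun H => h H.symm, ← smul_neg, ← neg_mul,
        ← neg_mul, neg_sub]
      congr 3
      rw [sub_eq_sub_iff_add_eq_add, Quaternion.self_add_star', two_mul, Quaternion.coe_add]
  have hsum : ∑ σ, f σ = ∑ σ, g σ := by
    have hsplit : ∑ σ, f σ = ∑ σ : Equiv.Perm (Fin n), (if σ.SameCycle i k then 0 else f σ) +
        ∑ σ : Equiv.Perm (Fin n), (if σ.SameCycle i k then f σ else 0) := by
      rw [← Finset.sum_add_distrib]
      exact Finset.sum_congr rfl fun σ _ => by split_ifs <;> simp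
    rw [hsplit, ← Equiv.sum_comp (Equiv.mulRight (Equiv.swap i k))
      fun σ => if σ.SameCycle i k then f σ else 0, ← Finset.sum_add_distrib]
    refine Finset.sum_congr rfl fun σ _ => ?_
    simp only [Equiv.coe_mulRight, sameCycle_mul_swap_iff_not hik]
    by_cases h : σ.SameCycle i k
    · simp [g, h]
    · rw [if_neg h, if_pos h, hpair σ h]
  rw [rdet_eq_sum_cycleProd_mul_re hM]
  change ∑ σ, f σ = 0
  rw [hsum, ← self_eq_neg, ← Finset.sum_neg_distrib]
  conv_lhs => rw [← sum_reverseCycle k]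
  exact Finset.sum_congr rfl fun σ _ => hrev σ

end Join

/-! ### Cramer's rule for Hermitian matrices -/

section Hermitian

variable {n : ℕ}

/-- The row determinant of a Hermitian matrix vanishes when its row is replaced by another row. -/
theorem rdet_updateRow_eq_zero {H : Matrix (Fin n) (Fin n) ℍ[ℝ]} (hH : H.IsHermitian)
    {i k : Fin n} (hik : i ≠ k) : rdet i (H.updateRow i (H k)) = 0 := by
  refine rdet_eq_zero_of_row_eq hik (fun a b ha hb => ?_) ?_
  · rw [Matrix.updateRow_ne ha, Matrix.updateRow_ne hb]
    exact hH.apply b a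
  · rw [Matrix.updateRow_self, Matrix.updateRow_ne hik.symm]

/-- Cramer's rule for the system `x ᵥ* H = z` with a Hermitian matrix `H`. -/
theorem rdet_updateRow_vecMul_self {H : Matrix (Fin n) (Fin n) ℍ[ℝ]} (hH : H.IsHermitian)
    (i : Fin n) (x : Fin n → ℍ[ℝ]) :
    rdet i (H.updateRow i (x ᵥ* H)) = x i * (hermitianDet H : ℍ[ℝ]) := by
  rw [rdet_updateRow_vecMul, Finset.sum_eq_single i]
  · rw [Matrix.updateRow_eq_self, rdet_eq_hermitianDet hH]
  · intro k _ hk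
    rw [rdet_updateRow_eq_zero hH hk.symm, mul_zero]
  · exact fun h => absurd (Finset.mem_univ i) h

/-- The column version of `rdet_updateRow_vecMul_self`, obtained from it by conjugation. -/
theorem rdet_updateCol_mulVec_self {H : Matrix (Fin n) (Fin n) ℍ[ℝ]} (hH : H.IsHermitian)
    (i : Fin n) (x : Fin n → ℍ[ℝ]) :
    rdet i (H.updateCol i (H *ᵥ x)) = (hermitianDet H : ℍ[ℝ]) * x i := by
  have h := star_rdet (i := i) (M := H.updateRow i (star x ᵥ* H)) fun a b ha hb => by
    rw [Matrix.updateRow_ne ha, Matrix.updateRow_ne hb]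
    exact hH.apply b a
  rw [rdet_updateRow_vecMul_self hH, ← Matrix.updateCol_conjTranspose, Matrix.star_vecMul, hH,
    star_star, star_mul, Quaternion.star_coe, Pi.star_apply, star_star] at h
  exact h.symm

/-! ### Congruence transformations and elimination -/

/-- The identity matrix with its `i`-th row replaced by `r`. -/
noncomputable def rowMatrix (i : Fin n) (r : Fin n → ℍ[ℝ]) : Matrix (Fin n) (Fin n) ℍ[ℝ] :=
  (1 : Matrix (Fin n) (Fin n) ℍ[ℝ]).updateRow i r

theorem rowMatrix_mul (i : Fin n) (r : Fin n → ℍ[ℝ]) (M : Matrix (Fin n) (Fin n) ℍ[ℝ]) :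
    rowMatrix i r * M = M.updateRow i (r ᵥ* M) := by
  rw [rowMatrix, Matrix.updateRow_mul, Matrix.one_mul]

theorem mul_rowMatrix_apply (i : Fin n) (r : Fin n → ℍ[ℝ]) (M : Matrix (Fin n) (Fin n) ℍ[ℝ])
    (a b : Fin n) :
    (M * rowMatrix i r) a b = M a i * r b + if b = i then 0 else M a b := by
  rw [Matrix.mul_apply, ← Finset.add_sum_erase _ _ (Finset.mem_univ i), rowMatrix,
    Matrix.updateRow_self]
  congr 1
  rw [Finset.sum_congr rfl fun k hk => by rw [Matrix.updateRow_ne (Finset.ne_of_mem_erase hk)]]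
  simp [Matrix.one_apply]

theorem mul_conjTranspose_rowMatrix (i : Fin n) (r : Fin n → ℍ[ℝ])
    (M : Matrix (Fin n) (Fin n) ℍ[ℝ]) :
    M * (rowMatrix i r)ᴴ = M.updateCol i (M *ᵥ star r) := by
  rw [← Matrix.conjTranspose_conjTranspose (M * _), Matrix.conjTranspose_mul,
    Matrix.conjTranspose_conjTranspose, rowMatrix_mul, ← Matrix.updateCol_conjTranspose,
    Matrix.star_vecMul, Matrix.conjTranspose_conjTranspose]

/-- A congruence that changes only the `i`-th row and column multiplies the determinant of a
Hermitian matrix by the norm of the diagonal entry. -/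
theorem hermitianDet_rowMatrix_mul_mul {H : Matrix (Fin n) (Fin n) ℍ[ℝ]} (hH : H.IsHermitian)
    (i : Fin n) (r : Fin n → ℍ[ℝ]) :
    hermitianDet (rowMatrix i r * H * (rowMatrix i r)ᴴ) =
      Quaternion.normSq (r i) * hermitianDet H := by
  set L := H * (rowMatrix i r)ᴴ with hL
  set K := rowMatrix i r * H * (rowMatrix i r)ᴴ with hK
  have hKH : K.IsHermitian := Matrix.isHermitian_mul_mul_conjTranspose _ hH
  have hKL : K = L.updateRow i (r ᵥ* L) := by rw [hK, Matrix.mul_assoc, rowMatrix_mul]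
  have hLK : K.updateRow i (L i) = L := by
    rw [hKL, Matrix.updateRow_idem, Matrix.updateRow_eq_self]
  have hrow (k : Fin n) (hk : k ≠ i) : L k = K k := by rw [hKL, Matrix.updateRow_ne hk]
  have hdet : rdet i K = r i * rdet i L := by
    have hself : K = K.updateRow i (r ᵥ* L) := by rw [hKL, Matrix.updateRow_idem]
    rw [hself, rdet_updateRow_vecMul, Finset.sum_eq_single i, hLK]
    · intro k _ hk
      rw [hrow k hk, rdet_updateRow_eq_zero hKH hk.symm, mul_zero]
    · exact fun h => absurd (Finset.mem_univ i) h
  apply Quaternion.coe_injective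
  rw [← rdet_eq_hermitianDet hKH i, hdet, hL, mul_conjTranspose_rowMatrix,
    rdet_updateCol_mulVec_self hH, Pi.star_apply, Quaternion.coe_commutes, ← mul_assoc,
    Quaternion.self_mul_star, Quaternion.coe_mul]

/-- The congruences by `A` and by `Aᴴ` multiply the determinants of all Hermitian matrices by one
and the same factor. -/
def HasMultiplier (A : Matrix (Fin n) (Fin n) ℍ[ℝ]) : Prop :=
  ∃ c : ℝ, ∀ H : Matrix (Fin n) (Fin n) ℍ[ℝ], H.IsHermitian →
    hermitianDet (A * H * Aᴴ) = c * hermitianDet H ∧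
      hermitianDet (Aᴴ * H * A) = c * hermitianDet H

theorem HasMultiplier.one : HasMultiplier (1 : Matrix (Fin n) (Fin n) ℍ[ℝ]) :=
  ⟨1, fun H _ => by simp⟩

theorem HasMultiplier.mul {A B : Matrix (Fin n) (Fin n) ℍ[ℝ]} (hA : HasMultiplier A)
    (hB : HasMultiplier B) : HasMultiplier (A * B) := by
  obtain ⟨c, hc⟩ := hA
  obtain ⟨d, hd⟩ := hB
  refine ⟨c * d, fun H hH => ⟨?_, ?_⟩⟩
  · have h1 := (hc _ (Matrix.isHermitian_mul_mul_conjTranspose B hH)).1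
    rw [(hd H hH).1] at h1
    rw [mul_assoc c, ← h1, Matrix.conjTranspose_mul]
    simp only [Matrix.mul_assoc]
  · have h1 := (hd _ (Matrix.isHermitian_conjTranspose_mul_mul A hH)).2
    rw [(hc H hH).2] at h1
    rw [mul_comm c, mul_assoc d, ← h1, Matrix.conjTranspose_mul]
    simp only [Matrix.mul_assoc]

/-- A row matrix whose conjugate transpose is again a row matrix has a multiplier. -/
theorem hasMultiplier_of_eq_rowMatrix {i j : Fin n} {r s : Fin n → ℍ[ℝ]}
    (h : (rowMatrix i r)ᴴ = rowMatrix j s)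
    (hrs : Quaternion.normSq (r i) = Quaternion.normSq (s j)) : HasMultiplier (rowMatrix i r) := by
  refine ⟨Quaternion.normSq (r i), fun H hH => ⟨hermitianDet_rowMatrix_mul_mul hH i r, ?_⟩⟩
  have h' : rowMatrix i r = (rowMatrix j s)ᴴ := by rw [← h, Matrix.conjTranspose_conjTranspose]
  rw [h, h', hermitianDet_rowMatrix_mul_mul hH j s, hrs]

theorem hasMultiplier_dilation (i : Fin n) (x : ℍ[ℝ]) :
    HasMultiplier (rowMatrix i (Pi.single i x)) := by
  refine hasMultiplier_of_eq_rowMatrix (j := i) (s := Pi.single i (star x)) ?_ (by simp)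
  refine Matrix.ext fun a b => ?_
  rw [Matrix.conjTranspose_apply]
  simp only [rowMatrix, Matrix.updateRow_apply, Matrix.one_apply, Pi.single_apply]
  split_ifs <;> grind [star_zero, star_one, star_star]

theorem hasMultiplier_transvection {i j : Fin n} (hij : i ≠ j) (x : ℍ[ℝ]) :
    HasMultiplier (rowMatrix i (Pi.single i 1 + Pi.single j x)) := by
  refine hasMultiplier_of_eq_rowMatrix (j := j) (s := Pi.single j 1 + Pi.single i (star x)) ?_
    (by simp [hij, hij.symm])
  refine Matrix.ext fun a b => ?_
  rw [Matrix.conjTranspose_apply]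
  simp only [rowMatrix, Matrix.updateRow_apply, Matrix.one_apply, Pi.single_apply, Pi.add_apply]
  split_ifs <;> grind [star_zero, star_one, star_star]

/-- A row matrix is a product of a dilation and transvections. -/
theorem hasMultiplier_rowMatrix (i : Fin n) (r : Fin n → ℍ[ℝ]) :
    HasMultiplier (rowMatrix i r) := by
  have key (s : Finset (Fin n)) (hs : i ∉ s) :
      HasMultiplier (rowMatrix i (Pi.single i (r i) + ∑ j ∈ s, Pi.single j (r j))) := by
    induction s using Finset.induction_on with
    | empty => simpa using hasMultiplier_dilation i (r i)
    | insert j s hj ih =>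
      rw [Finset.mem_insert, not_or] at hs
      have h := (hasMultiplier_transvection hs.1 (r j)).mul (ih hs.2)
      rw [rowMatrix_mul, rowMatrix, Matrix.updateRow_idem, Matrix.add_vecMul,
        Matrix.single_vecMul, Matrix.single_vecMul] at h
      rw [Finset.sum_insert hj, add_left_comm, add_comm]
      convert h using 1
      rw [rowMatrix]
      congr 1
      refine funext fun b => ?_
      simp [Matrix.updateRow_ne (Ne.symm hs.1), Matrix.one_apply, Pi.single_apply, eq_comm]
  have hr : Pi.single i (r i) + ∑ j ∈ Finset.univ.erase i, Pi.single j (r j) = r := by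
    rw [Finset.add_sum_erase _ (fun j => Pi.single j (r j)) (Finset.mem_univ i)]
    exact Finset.univ_sum_single r
  rw [← hr]
  exact key _ (Finset.notMem_erase _ _)

/-- Gaussian elimination by column operations: every invertible matrix is a product of row
matrices. -/
theorem hasMultiplier_of_isUnit {A : Matrix (Fin n) (Fin n) ℍ[ℝ]} (hA : IsUnit A) :
    HasMultiplier A := by
  have of_mul {A B R : Matrix (Fin n) (Fin n) ℍ[ℝ]} (hA : IsUnit A) (h : A = B * R) :
      IsUnit B := by
    obtain ⟨A', hA'⟩ := hA.exists_right_inv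
    exact IsUnit.of_mul_eq_one (R * A') (by rw [← Matrix.mul_assoc, ← h, hA'])
  -- Only the rows with index in `s` may differ from those of the identity matrix.
  suffices key : ∀ s : Finset (Fin n), ∀ A : Matrix (Fin n) (Fin n) ℍ[ℝ], IsUnit A →
      (∀ a ∉ s, A a = (1 : Matrix (Fin n) (Fin n) ℍ[ℝ]) a) → HasMultiplier A from
    key Finset.univ A hA fun a ha => absurd (Finset.mem_univ a) ha
  intro s
  induction s using Finset.induction_on with
  | empty =>
    intro A _ h
    rw [show A = 1 from funext fun a => h a (Finset.notMem_empty a)]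
    exact HasMultiplier.one
  | insert i s hi ih =>
    have pivot (A : Matrix (Fin n) (Fin n) ℍ[ℝ]) (hA : IsUnit A)
        (h : ∀ a ∉ insert i s, A a = (1 : Matrix (Fin n) (Fin n) ℍ[ℝ]) a) (hii : A i i ≠ 0) :
        HasMultiplier A := by
      -- `B` is `A` after the column operations that turn row `i` into that of the identity.
      set B : Matrix (Fin n) (Fin n) ℍ[ℝ] := Matrix.of fun a b =>
        if b = i then A a i * (A i i)⁻¹ else A a b - A a i * (A i i)⁻¹ * A i b with hB
      have hAB : A = B * rowMatrix i (A i) := by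
        refine Matrix.ext fun a b => ?_
        rw [mul_rowMatrix_apply, hB, Matrix.of_apply, Matrix.of_apply, if_pos rfl]
        by_cases hb : b = i
        · rw [if_pos hb, add_zero, hb, mul_assoc, inv_mul_cancel₀ hii, mul_one]
        · rw [if_neg hb, if_neg hb, add_sub_cancel]
      rw [hAB]
      refine (ih B (of_mul hA hAB) fun a ha => funext fun b => ?_).mul
        (hasMultiplier_rowMatrix i (A i))
      rw [hB, Matrix.of_apply]
      by_cases hai : a = i
      · subst hai
        by_cases hb : b = a
        · rw [if_pos hb, mul_inv_cancel₀ hii, hb, Matrix.one_apply_eq]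
        · rw [if_neg hb, mul_inv_cancel₀ hii, one_mul, sub_self, Matrix.one_apply_ne (Ne.symm hb)]
      · have haA := h a (by simp [hai, ha])
        rw [haA, Matrix.one_apply_ne hai]
        split_ifs with hb
        · rw [hb, Matrix.one_apply_ne hai, zero_mul]
        · simp
    intro A hA h
    by_cases hii : A i i = 0
    · obtain ⟨j, hj, hAj⟩ : ∃ j ∈ insert i s, A i j ≠ 0 := by
        by_contra! hcon
        -- Otherwise row `i` is a combination of the rows of index outside `insert i s`.
        obtain ⟨A', hA'⟩ := hA.exists_right_inv
        have hrow : A i ᵥ* A = A i := by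
          refine funext fun b => ?_
          have : ∀ a, A i a * A a b = A i a * (1 : Matrix (Fin n) (Fin n) ℍ[ℝ]) a b := by
            intro a
            by_cases ha : a ∈ insert i s
            · rw [hcon a ha, zero_mul, zero_mul]
            · rw [h a ha]
          simp only [Matrix.vecMul, dotProduct, this]
          simp [Matrix.one_apply]
        have hone : A i = (1 : Matrix (Fin n) (Fin n) ℍ[ℝ]) i := by
          calc A i = (A i ᵥ* A) ᵥ* A' := by rw [Matrix.vecMul_vecMul, hA', Matrix.vecMul_one]
            _ = A i ᵥ* A' := by rw [hrow]
            _ = (A * A') i := rfl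
            _ = _ := by rw [hA']
        rw [hone, Matrix.one_apply_eq] at hii
        exact one_ne_zero hii
      have hji : j ≠ i := fun H => hAj (H ▸ hii)
      -- Adding column `j` to column `i` makes the pivot nonzero.
      set B : Matrix (Fin n) (Fin n) ℍ[ℝ] := Matrix.of fun a b =>
        A a b + if b = i then A a j else 0 with hB
      have hAB : A = B * rowMatrix j (Pi.single j 1 + Pi.single i (-1)) := by
        refine Matrix.ext fun a b => ?_
        rw [mul_rowMatrix_apply, hB, Matrix.of_apply, Matrix.of_apply, if_neg hji, add_zero]
        by_cases hbj : b = j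
        · subst hbj
          simp [hji]
        · by_cases hbi : b = i
          · subst hbi
            simp [hbj]
          · simp [hbj, hbi]
      rw [hAB]
      refine (pivot B (of_mul hA hAB) (fun a ha => ?_) ?_).mul (hasMultiplier_rowMatrix _ _)
      · refine funext fun b => ?_
        have haj : a ≠ j := fun H => ha (H ▸ hj)
        rw [hB, Matrix.of_apply, h a ha, Matrix.one_apply_ne haj, ite_self, add_zero]
      · rw [hB, Matrix.of_apply, if_pos rfl, hii, zero_add]
        exact hAj
    · exact pivot A hA h hii

/-- The two Hermitian products of an invertible matrix with its conjugate transpose have the same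
determinant. -/
theorem hermitianDet_mul_conjTranspose {A : Matrix (Fin n) (Fin n) ℍ[ℝ]} (hA : IsUnit A) :
    hermitianDet (A * Aᴴ) = hermitianDet (Aᴴ * A) := by
  obtain ⟨c, hc⟩ := hasMultiplier_of_isUnit hA
  have h := hc 1 Matrix.isHermitian_one
  rw [Matrix.mul_one, Matrix.mul_one] at h
  rw [h.1, h.2]

theorem isUnit_of_hermitianDet_ne_zero {A : Matrix (Fin n) (Fin n) ℍ[ℝ]}
    (hA : hermitianDet (Aᴴ * A) ≠ 0) : IsUnit A := by
  have hinj : Function.Injective (Matrix.vecMulLinear (Aᴴ * A)) := by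
    rw [injective_iff_map_eq_zero]
    intro x hx
    rw [Matrix.vecMulLinear_apply] at hx
    refine funext fun i => ?_
    have h := rdet_updateRow_vecMul_self (Matrix.isHermitian_conjTranspose_mul_self A) i x
    have h0 := rdet_updateRow_vecMul_self (Matrix.isHermitian_conjTranspose_mul_self A) i 0
    rw [hx] at h
    rw [Matrix.zero_vecMul, h, Pi.zero_apply, zero_mul] at h0
    exact (mul_eq_zero.1 h0).resolve_right fun H => hA (Quaternion.coe_injective H)
  have hsurj := LinearMap.injective_iff_surjective.1 hinj
  choose B hB using fun k => hsurj ((1 : Matrix (Fin n) (Fin n) ℍ[ℝ]) k)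
  have hBA : Matrix.of B * (Aᴴ * A) = 1 := funext fun k => hB k
  rw [← Matrix.mul_assoc] at hBA
  exact IsUnit.of_mul_eq_one_right _ hBA

end Hermitian

/-! ### Cramer's rule for left systems -/

theorem theorem9p2 {n : ℕ} [NeZero n] (A : Matrix (Fin n) (Fin n) ℍ[ℝ]) (y : Fin n → ℍ[ℝ])
    (hA : ddet A ≠ 0) :
    (∃! x : Fin n → ℍ[ℝ], x ᵥ* A = y) ∧
      ∀ x : Fin n → ℍ[ℝ], x ᵥ* A = y →
        ∀ i : Fin n, x i = rdet i ((A * Aᴴ).updateRow i (y ᵥ* Aᴴ)) / ddet A := by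
  have hdet : ddet A = (hermitianDet (Aᴴ * A) : ℍ[ℝ]) :=
    rdet_eq_hermitianDet (Matrix.isHermitian_conjTranspose_mul_self A) 0
  have hunit : IsUnit A := isUnit_of_hermitianDet_ne_zero fun h => hA (by rw [hdet, h]; rfl)
  constructor
  · obtain ⟨⟨A, B, hAB, hBA⟩, rfl⟩ := hunit
    refine ⟨y ᵥ* B, ?_, fun x hx => ?_⟩
    · change (y ᵥ* B) ᵥ* A = y
      rw [Matrix.vecMul_vecMul, hBA, Matrix.vecMul_one]
    · change x ᵥ* A = y at hx
      rw [← hx, Matrix.vecMul_vecMul, hAB, Matrix.vecMul_one]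
  · intro x hx i
    have hcramer := rdet_updateRow_vecMul_self (Matrix.isHermitian_mul_conjTranspose_self A) i x
    rw [hermitianDet_mul_conjTranspose hunit, ← hdet, ← Matrix.vecMul_vecMul, hx] at hcramer
    rw [hcramer, mul_div_cancel_right₀ _ hA]
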